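/- Let $X$, $\theta$, $Y$ be random variables with finitely many possible values $x_1,\dots,x_L$; $s_1,\dots,s_K$; $y_1,\dots,y_J$, and let $(X_i,Y_i,\theta_i)$, $i=1,2,\dots$, be independent copies of $(X,Y,\theta)\sim G^*$. The joint law of $(X,\theta)$, $g_{lk}=P_{G^*}(X=x_l,\theta=s_k)$, is unknown, and the conditional law of $Y$ given $(X,\theta)=(x_l,s_k)$ is known for all $l,k$. For a given function $\mathcal T$ only $\mathcal T(X_i,Y_i)$, $i=1,\dots,n$, are observed. Let $t_1,\dots,t_Q$, $Q\ge 2$, be the distinct values of $\mathcal T(x_l,y_j)$, let $\hat f_j$ be the proportion of $i\le n$ with $\mathcal T(X_i,Y_i)=t_j$, and let $\hat f^*=(\hat f_1,\dots,\hat f_{Q-1})'$. Let $P^*$ be the $(Q-1)\times LK$ matrix with entries $P(\mathcal T(X,Y)=t_j\mid X=x_l,\theta=s_k)$, $j\le Q-1$. Let $\Sigma^*$ be the covariance matrix, under $G^*$, of the vector of indicators $(1\{\mathcal T(X,Y)=t_j\})_{j\le Q-1}$ (so that $\Sigma^*/n$ is the covariance matrix of $\hat f^*$), and let $\hat\Sigma^*$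 be the corresponding empirical covariance matrix of the $n$ observations (with normalization $1/n$). For a real function $h$ and $0<\alpha<1$, let $\chi^2_{Q-1,1-\alpha}$ be the $(1-\alpha)$-quantile of the chi-square distribution with $Q-1$ degrees of freedom, and let $T_U$ and $T_L$ be the supremum and the infimum of $\sum_{l,k}h(x_l,s_k)\gamma_{lk}$ over all probability vectors $\gamma=(\gamma_{lk})$ with $$n(\hat f^*-P^*\gamma)'\,\hat\Sigma^{*-1}(\hat f^*-P^*\gamma)<\chi^2_{Q-1,1-\alpha}$$ ($T_U=-\infty$ and $T_L=+\infty$ if there is no such $\gamma$). **Theorem 1.** If $\Sigma^*$ is non-singular, then the interval with endpoints $T_L,T_U$ is asymptotically a $(1-\alpha)$-level confidence interval for $T=E_{G^*}h(X,\theta)=\sum_{l,k}h(x_l,s_k)g_{lk}$: $$\liminf_{n\to\infty}P\big(\hat\Sigma^*\text{ is non-singular and } T_L\le T\le T_U\big)\ge 1-\alpha .$$ If moreover $\min_{l,k}h(x_l,s_k)<T<\max_{l,k}h(x_l,s_k)$, then the same holds for the open interval: $$\liminf_{n\to\infty}P\big(\hat\Sigma^*\text{ is non-singular and } T_L<T<T_U\big)\ge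 1-\alpha .$$ -/

import Mathlib

open MeasureTheory ProbabilityTheory Filter Matrix

namespace DeconvCI

noncomputable section

/-- The chi-square distribution with `k` degrees of freedom: the law of the sum of the squares
of `k` independent standard normal variables. -/
def chiSquare (k : ℕ) : Measure ℝ :=
  (Measure.pi fun _ : Fin k => gaussianReal 0 1).map fun z => ∑ i, z i ^ 2

/-- The critical value of the `α`-level chi-square test with `k` degrees of freedom, i.e. the
`1 - α` quantile of the chi-square distribution. -/
def chiSquareCrit (k : ℕ) (α : ℝ) : ℝ :=
  sInf {c : ℝ | ENNReal.ofReal (1 - α) ≤ chiSquare k (Set.Iic c)}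

section Model

variable {𝒳 𝒴 𝒮 τ : Type*} {q : ℕ}

/-- The joint law `G*` of `(X, Y, θ)`: the pair `(X, θ)` has law `g`, and the conditional law of
`Y` given `(X, θ) = v` is `κ v`. -/
def jointLaw (g : PMF (𝒳 × 𝒮)) (κ : 𝒳 × 𝒮 → PMF 𝒴) : PMF (𝒳 × 𝒴 × 𝒮) :=
  g.bind fun v => (κ v).map fun y => (v.1, y, v.2)

/-- The matrix `P`, with entries `P(𝒯(X, Y) = t j | (X, θ) = v)`. -/
def mixMatrix (κ : 𝒳 × 𝒮 → PMF 𝒴) (obs : 𝒳 × 𝒴 → τ) (t : Fin (q + 1) → τ) :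
    Matrix (Fin (q + 1)) (𝒳 × 𝒮) ℝ :=
  Matrix.of fun j v => ((κ v).map (fun y => obs (v.1, y)) (t j)).toReal

/-- The matrix `P*`: the matrix `P` without its last row. -/
def mixMatrixStar (κ : 𝒳 × 𝒮 → PMF 𝒴) (obs : 𝒳 × 𝒴 → τ) (t : Fin (q + 1) → τ) :
    Matrix (Fin q) (𝒳 × 𝒮) ℝ :=
  (mixMatrix κ obs t).submatrix Fin.castSucc id

/-- The `0`-`1` indicator of the event that an observation `z` equals `a`. -/
def ind (a z : τ) : ℝ := Set.indicator {a} (fun _ => (1 : ℝ)) z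

/-- The matrix `Σ*`: the covariance matrix, under `G*`, of the vector of indicators of the events
`𝒯(X, Y) = t j`, with the last `j` left out. For `n` independent observations the
covariance matrix of the vector of sample proportions is `Σ* / n`. -/
def covStar [MeasurableSpace 𝒳] [MeasurableSpace 𝒴] [MeasurableSpace 𝒮]
    (g : PMF (𝒳 × 𝒮)) (κ : 𝒳 × 𝒮 → PMF 𝒴) (obs : 𝒳 × 𝒴 → τ) (t : Fin (q + 1) → τ) :
    Matrix (Fin q) (Fin q) ℝ :=
  Matrix.of fun j k =>
    cov[fun z : 𝒳 × 𝒴 × 𝒮 => ind (t j.castSucc) (obs (z.1, z.2.1)),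
      fun z : 𝒳 × 𝒴 × 𝒮 => ind (t k.castSucc) (obs (z.1, z.2.1)); (jointLaw g κ).toMeasure]

/-- The sample proportions `f̂` of the values `t j` among the first `n` observations. -/
def empFreq (t : Fin (q + 1) → τ) (z : ℕ → τ) (n : ℕ) : Fin (q + 1) → ℝ :=
  fun j => (∑ i ∈ Finset.range n, ind (t j) (z i)) / n

/-- The vector `f̂*`: the vector `f̂` without its last coordinate. -/
def empFreqStar (t : Fin (q + 1) → τ) (z : ℕ → τ) (n : ℕ) : Fin q → ℝ :=
  fun j => empFreq t z n j.castSucc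

/-- The empirical covariance matrix `Σ̂*` of the first `n` vectors of indicators (last coordinate
left out). -/
def empCovStar (t : Fin (q + 1) → τ) (z : ℕ → τ) (n : ℕ) : Matrix (Fin q) (Fin q) ℝ :=
  Matrix.of fun j k =>
    (∑ i ∈ Finset.range n,
      (ind (t j.castSucc) (z i) - empFreqStar t z n j) *
        (ind (t k.castSucc) (z i) - empFreqStar t z n k)) / n

variable [Fintype 𝒳] [Fintype 𝒮]

/-- The statistic `n (f̂* - P* γ)' Σ̂*⁻¹ (f̂* - P* γ)`. -/
def quadStat (κ : 𝒳 × 𝒮 → PMF 𝒴) (obs : 𝒳 × 𝒴 → τ) (t : Fin (q + 1) → τ)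
    (z : ℕ → τ) (n : ℕ) (γ : 𝒳 × 𝒮 → ℝ) : ℝ :=
  n * ((empFreqStar t z n - mixMatrixStar κ obs t *ᵥ γ) ⬝ᵥ
    ((empCovStar t z n)⁻¹ *ᵥ (empFreqStar t z n - mixMatrixStar κ obs t *ᵥ γ)))

/-- The constraint set of the two optimization problems. -/
def feasible (κ : 𝒳 × 𝒮 → PMF 𝒴) (obs : 𝒳 × 𝒴 → τ) (t : Fin (q + 1) → τ)
    (α : ℝ) (z : ℕ → τ) (n : ℕ) : Set (𝒳 × 𝒮 → ℝ) :=
  {γ | γ ∈ stdSimplex ℝ (𝒳 × 𝒮) ∧ quadStat κ obs t z n γ < chiSquareCrit q α}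

/-- The upper endpoint `T_U`, an extended real so that it is `-∞` if no `γ` is feasible. -/
def upperEnd (κ : 𝒳 × 𝒮 → PMF 𝒴) (obs : 𝒳 × 𝒴 → τ) (t : Fin (q + 1) → τ)
    (h : 𝒳 × 𝒮 → ℝ) (α : ℝ) (z : ℕ → τ) (n : ℕ) : EReal :=
  ⨆ γ ∈ feasible κ obs t α z n, ((∑ v, h v * γ v : ℝ) : EReal)

/-- The lower endpoint `T_L`, an extended real so that it is `+∞` if no `γ` is feasible. -/
def lowerEnd (κ : 𝒳 × 𝒮 → PMF 𝒴) (obs : 𝒳 × 𝒴 → τ) (t : Fin (q + 1) → τ)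
    (h : 𝒳 × 𝒮 → ℝ) (α : ℝ) (z : ℕ → τ) (n : ℕ) : EReal :=
  ⨅ γ ∈ feasible κ obs t α z n, ((∑ v, h v * γ v : ℝ) : EReal)

end Model

/-- The quantity `T = E_{G*} h(X, θ)`. -/
def target {𝒳 𝒴 𝒮 : Type*} [MeasurableSpace 𝒳] [MeasurableSpace 𝒴] [MeasurableSpace 𝒮]
    (g : PMF (𝒳 × 𝒮)) (κ : 𝒳 × 𝒮 → PMF 𝒴) (h : 𝒳 × 𝒮 → ℝ) : ℝ :=
  ∫ z, h (z.1, z.2.2) ∂(jointLaw g κ).toMeasure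

end

end DeconvCI

/-!
The argument tests the true weight vector `g` (the joint law of `(X, θ)`). Whenever `g` satisfies
the constraint `n (f̂* - P* g)' Σ̂*⁻¹ (f̂* - P* g) < χ²`, it is feasible, so `T = ∑ h g` lies between
`T_L` and `T_U`. The constraint is strict and the statistic is continuous in the weights, so a
small step from `g` towards a vertex `w` of the simplex stays feasible; if `h w > T` (resp.
`h w < T`) this step moves the objective strictly, and `T < T_U` (resp. `T_L < T`). This is
`lt_upperEnd` and `lowerEnd_lt`. Both coverage events thus contain the single event that `Σ̂*` is
non-singular and the chi-square test accepts `g`.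

The probability of that event has limit inferior at least `1 - α` (`le_liminf_measure_quadStat_lt`).
As `P* g` is the mean of the vector of indicators, `√n (f̂* - P* g)` converges in distribution to
`N(0, Σ*)`, by the multivariate central limit theorem
(`tendstoInDistribution_inv_sqrt_smul_sum_sub`). By the strong law of large numbers `Σ̂* → Σ*`
almost surely, and by Slutsky's theorem the pair converges in distribution. The set of pairs
`(w, S)` with `det S ≠ 0` and `w' S⁻¹ w < c` is open, so the portmanteau theorem bounds the limit
inferior below by the probability that `w' Σ*⁻¹ w < c` for `w ∼ N(0, Σ*)`, which is the chi-square
probability of `(-∞, c)` (`le_liminf_measure_quadForm_lt`). For the `1 - α` quantile `c` this is at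
least `1 - α`, because the chi-square distribution has no atoms (`le_chiSquare_Iio_chiSquareCrit`).
-/

namespace DeconvCI

/-! ### The chi-square distribution -/

instance isProbabilityMeasure_chiSquare (k : ℕ) : IsProbabilityMeasure (chiSquare k) :=
  Measure.isProbabilityMeasure_map (Measurable.aemeasurable (by fun_prop))

/-- The chi-square distribution has no atoms: given all coordinates of `z` but one, at most two
values of the remaining one make `∑ i, z i ^ 2` equal to `c`. -/
theorem chiSquare_singleton (k : ℕ) (hk : 1 ≤ k) (c : ℝ) : chiSquare k {c} = 0 := by
  obtain ⟨m, rfl⟩ : ∃ m, k = m + 1 := ⟨k - 1, by omega⟩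
  have : NullSingletonClass (gaussianReal 0 1) := nullSingletonClass_gaussianReal one_ne_zero
  set e := MeasurableEquiv.piFinSuccAbove (fun _ : Fin (m + 1) => ℝ) (Fin.last m)
  have he := measurePreserving_piFinSuccAbove
    (fun _ : Fin (m + 1) => gaussianReal 0 1) (Fin.last m)
  have hs : MeasurableSet {p : ℝ × (Fin m → ℝ) | p.1 ^ 2 + ∑ i, p.2 i ^ 2 = c} :=
    measurableSet_eq_fun (by fun_prop) (by fun_prop)
  have hpre : (fun z : Fin (m + 1) → ℝ => ∑ i, z i ^ 2) ⁻¹' {c} =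
      e ⁻¹' {p : ℝ × (Fin m → ℝ) | p.1 ^ 2 + ∑ i, p.2 i ^ 2 = c} := by
    ext z
    simp [e, MeasurableEquiv.piFinSuccAbove, Fin.sum_univ_castSucc, Fin.insertNthEquiv,
      Fin.init, add_comm]
  rw [chiSquare, Measure.map_apply (by fun_prop) (measurableSet_singleton c), hpre,
    he.measure_preimage hs.nullMeasurableSet, ← Measure.prod_swap,
    Measure.map_apply measurable_swap hs, Measure.measure_prod_null (measurable_swap hs)]
  refine ae_of_all _ fun x => ?_
  refine Set.Finite.measure_zero (Set.Finite.subset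
    (Set.toFinite {√(c - ∑ i, x i ^ 2), -√(c - ∑ i, x i ^ 2)}) fun y hy => ?_) _
  have hy' : y ^ 2 = c - ∑ i, x i ^ 2 := by
    have : y ^ 2 + ∑ i, x i ^ 2 = c := hy
    linarith
  rw [← hy', Real.sqrt_sq_eq_abs]
  rcases abs_choice y with h | h <;> simp [h]

/-- The critical value is attained, by right continuity of the distribution function; the
inequality for the open half-line then follows from the absence of atoms. -/
theorem le_chiSquare_Iio_chiSquareCrit (k : ℕ) (hk : 1 ≤ k) {α : ℝ} (hα_pos : 0 < α) :
    ENNReal.ofReal (1 - α) ≤ chiSquare k (Set.Iio (chiSquareCrit k α)) := by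
  have hset : {c : ℝ | ENNReal.ofReal (1 - α) ≤ chiSquare k (Set.Iic c)} =
      {c : ℝ | 1 - α ≤ cdf (chiSquare k) c} := by
    ext c
    rw [Set.mem_ofPred_eq, Set.mem_ofPred_eq, ← ofReal_cdf,
      ENNReal.ofReal_le_ofReal_iff (cdf_nonneg _ _)]
  have hne : {c : ℝ | 1 - α ≤ cdf (chiSquare k) c}.Nonempty :=
    ((tendsto_cdf_atTop (chiSquare k)).eventually (eventually_ge_nhds (by linarith))).exists
  have hcrit : 1 - α ≤ cdf (chiSquare k) (chiSquareCrit k α) := by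
    rw [← StieltjesFunction.iInf_Ioi_eq]
    refine le_ciInf fun r => ?_
    have hr : sInf {c : ℝ | 1 - α ≤ cdf (chiSquare k) c} < r := by
      rw [← hset]
      exact r.2
    obtain ⟨b, hb, hbr⟩ := exists_lt_of_csInf_lt hne hr
    exact hb.trans (monotone_cdf _ hbr.le)
  have hIic : chiSquare k (Set.Iic (chiSquareCrit k α)) =
      chiSquare k (Set.Iio (chiSquareCrit k α)) := by
    have : NullSingletonClass (chiSquare k) := ⟨chiSquare_singleton k hk⟩
    exact (measure_congr Iio_ae_eq_Iic).symm
  rw [← hIic, ← ofReal_cdf]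
  exact ENNReal.ofReal_le_ofReal hcrit

/-! ### The multivariate central limit theorem -/

section CLT

variable {ι Ω : Type*} [Fintype ι] [MeasurableSpace Ω] {P : Measure Ω}

/-- The covariance matrix of a random vector. -/
noncomputable def covMat (V : Ω → EuclideanSpace ℝ ι) (P : Measure Ω) : Matrix ι ι ℝ :=
  Matrix.of fun i j => cov[fun ω => V ω i, fun ω => V ω j; P]

variable [IsProbabilityMeasure P]

theorem variance_inner_eq_covMat {V : Ω → EuclideanSpace ℝ ι}
    (hV : ∀ i, MemLp (fun ω => V ω i) 2 P) (t : EuclideanSpace ℝ ι) :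
    Var[fun ω => inner ℝ (V ω) t; P] = t ⬝ᵥ covMat V P *ᵥ t := by
  have h : (fun ω => inner ℝ (V ω) t) = fun ω => ∑ i, t i * V ω i := by
    ext ω; simp [PiLp.inner_apply]
  rw [h, variance_fun_sum' fun i _ => (hV i).const_mul _]
  simp [covariance_const_mul_left, covariance_const_mul_right, dotProduct, mulVec, covMat,
    Finset.mul_sum, mul_comm, mul_left_comm]

theorem posSemidef_covMat {V : Ω → EuclideanSpace ℝ ι}
    (hV : ∀ i, MemLp (fun ω => V ω i) 2 P) : (covMat V P).PosSemidef := by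
  refine PosSemidef.of_dotProduct_mulVec_nonneg ?_ fun x => ?_
  · ext i j
    simp [covMat, covariance_comm]
  · have := variance_inner_eq_covMat hV (WithLp.toLp 2 x)
    simp only [star_trivial]
    rw [← WithLp.ofLp_toLp 2 x, ← this]
    exact variance_nonneg _ _

/-- The multivariate **central limit theorem**. By Lévy's convergence theorem it suffices that the
characteristic functions converge at each `t`; these are the characteristic functions at `1` of
the projections on `t`, to which the one-dimensional theorem applies. -/
theorem tendstoInDistribution_inv_sqrt_smul_sum_sub [DecidableEq ι]
    {V : ℕ → Ω → EuclideanSpace ℝ ι} (hV : ∀ i, MemLp (fun ω => V 0 ω i) 2 P)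
    (hindep : iIndepFun V P) (hident : ∀ k, IdentDistrib (V k) (V 0) P P) :
    TendstoInDistribution
      (fun (n : ℕ) ω => (√n)⁻¹ • (∑ k ∈ Finset.range n, V k ω -
        (n : ℝ) • WithLp.toLp 2 fun i => ∫ ω, V 0 ω i ∂P))
      atTop id (fun _ => P) (multivariateGaussian 0 (covMat (V 0) P)) where
  forall_aemeasurable n := by
    have hm (k : ℕ) := (hident k).aemeasurable_fst
    fun_prop
  tendsto := by
    refine ProbabilityMeasure.tendsto_iff_tendsto_charFun.2 fun t => ?_
    have hS := posSemidef_covMat hV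
    have hmeas : Measurable fun x : EuclideanSpace ℝ ι => inner ℝ x t := by fun_prop
    have hLp : MemLp (fun ω => inner ℝ (V 0 ω) t) 2 P := by
      have h : (fun ω => inner ℝ (V 0 ω) t) = fun ω => ∑ i, t i * V 0 ω i := by
        ext ω; simp [PiLp.inner_apply]
      rw [h]
      exact memLp_finsetSum _ fun i _ => (hV i).const_mul _
    have hmean : ∫ ω, inner ℝ (V 0 ω) t ∂P =
        inner ℝ (WithLp.toLp 2 fun i => ∫ ω, V 0 ω i ∂P) t := by
      simp only [PiLp.inner_apply, RCLike.inner_apply, conj_trivial]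
      rw [integral_finsetSum _ fun i _ => ((hV i).integrable one_le_two).const_mul _]
      simp [integral_const_mul]
    have h1 := tendstoInDistribution_inv_sqrt_mul_sum_sub (P := P)
      (P' := gaussianReal 0 Var[fun ω => inner ℝ (V 0 ω) t; P].toNNReal) (Y := id)
      (X := fun k ω => inner ℝ (V k ω) t) ⟨by fun_prop, by simp⟩ hLp
      (hindep.comp (fun _ x => inner ℝ x t) fun _ => hmeas)
      (fun k => (hident k).comp hmeas)
    have h2 := ProbabilityMeasure.tendsto_iff_tendsto_charFun.1 h1.tendsto 1
    convert! h2 using 2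
    · simp only [ProbabilityMeasure.coe_mk]
      rw [charFun_apply, charFun_apply, integral_map, integral_map]
      · simp [inner_smul_left, inner_sub_left, sum_inner, hmean]
      · exact h1.forall_aemeasurable _
      · fun_prop
      · have hm (k : ℕ) := (hident k).aemeasurable_fst
        fun_prop
      · fun_prop
    · simp only [ProbabilityMeasure.coe_mk, Measure.map_id]
      rw [charFun_multivariateGaussian hS, charFun_gaussianReal,
        Real.coe_toNNReal _ (variance_nonneg _ _), variance_inner_eq_covMat hV]
      simp

end CLT

/-- If `w ∼ N(0, S)` with `S` non-singular, then `w' S⁻¹ w` is chi-square distributed: `w` has the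
law of `S^{1/2} z` with `z` standard normal, and the quadratic form becomes `z' z`. -/
theorem map_dotProduct_inv_mulVec_multivariateGaussian {q : ℕ} {S : Matrix (Fin q) (Fin q) ℝ}
    (hS : S.PosSemidef) (hdet : S.det ≠ 0) :
    (multivariateGaussian 0 S).map (fun x => x.ofLp ⬝ᵥ S⁻¹ *ᵥ x.ofLp) = chiSquare q := by
  open scoped MatrixOrder in
  set R := CFC.sqrt S with hR
  have hRR : R * R = S := CFC.sqrt_mul_sqrt_self S hS.nonneg
  have hRt : Rᵀ = R := by
    have : R.IsHermitian := (CFC.sqrt_nonneg S).isSelfAdjoint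
    simpa [IsHermitian, conjTranspose_eq_transpose_of_trivial] using this
  have hRu : IsUnit R.det := by
    rw [isUnit_iff_ne_zero]
    rintro h
    apply hdet
    rw [← hRR, det_mul, h, zero_mul]
  have hquad (z : Fin q → ℝ) : (R *ᵥ z) ⬝ᵥ S⁻¹ *ᵥ (R *ᵥ z) = ∑ i, z i ^ 2 := by
    rw [dotProduct_mulVec, dotProduct_mulVec, ← vecMul_transpose, hRt, vecMul_vecMul,
      vecMul_vecMul, ← hRR, Matrix.mul_inv_rev, Matrix.mul_assoc,
      nonsing_inv_mul _ hRu, Matrix.mul_one, mul_nonsing_inv _ hRu, vecMul_one]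
    simp [dotProduct, sq]
  unfold multivariateGaussian
  rw [← map_pi_eq_stdGaussian, Measure.map_map, Measure.map_map, chiSquare]
  · congr 1
    ext z
    simp only [Function.comp_apply, zero_add]
    rw [← hquad z]
    rfl
  all_goals fun_prop

/-! ### Asymptotics of studentized quadratic forms -/

section Wald

variable {Ω : Type*} [MeasurableSpace Ω] {P : Measure Ω} [IsProbabilityMeasure P]

theorem isOpen_setOf_det_ne_zero_and_quadForm_lt (q : ℕ) (c : ℝ) :
    IsOpen {p : EuclideanSpace ℝ (Fin q) × (Fin q → Fin q → ℝ) |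
      (Matrix.of p.2).det ≠ 0 ∧ p.1.ofLp ⬝ᵥ (Matrix.of p.2)⁻¹ *ᵥ p.1.ofLp < c} := by
  have hdet : Continuous fun p : EuclideanSpace ℝ (Fin q) × (Fin q → Fin q → ℝ) =>
      (Matrix.of p.2).det := Continuous.matrix_det continuous_snd
  rw [isOpen_iff_mem_nhds]
  rintro p ⟨hp, hpc⟩
  have hcont : ContinuousAt (fun p : EuclideanSpace ℝ (Fin q) × (Fin q → Fin q → ℝ) =>
      p.1.ofLp ⬝ᵥ (Matrix.of p.2)⁻¹ *ᵥ p.1.ofLp) p := by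
    simp only [inv_def, smul_mulVec, dotProduct_smul, Ring.inverse_eq_inv', smul_eq_mul]
    refine (hdet.continuousAt.inv₀ hp).mul (Continuous.continuousAt ?_)
    have h1 : Continuous fun p : EuclideanSpace ℝ (Fin q) × (Fin q → Fin q → ℝ) =>
        p.1.ofLp := by fun_prop
    exact h1.dotProduct ((Continuous.matrix_adjugate continuous_snd).matrix_mulVec h1)
  exact (hdet.continuousAt.eventually_ne hp).and (hcont.eventually_lt continuousAt_const hpc)

/-- A quadratic form in the standardized sample mean `W n`, with matrix the inverse of a strongly
consistent estimator `C n` of the covariance matrix, is asymptotically chi-square. Only the lower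
bound for half-lines `(-∞, c)` is stated. -/
theorem le_liminf_measure_quadForm_lt {q : ℕ} {V : ℕ → Ω → EuclideanSpace ℝ (Fin q)}
    (hV : ∀ i, MemLp (fun ω => V 0 ω i) 2 P) (hindep : iIndepFun V P)
    (hident : ∀ k, IdentDistrib (V k) (V 0) P P) (hdet : (covMat (V 0) P).det ≠ 0)
    {C : ℕ → Ω → Fin q → Fin q → ℝ} (hC_meas : ∀ n, Measurable (C n))
    (hC : ∀ᵐ ω ∂P, ∀ i j, Tendsto (fun n => C n ω i j) atTop (nhds (covMat (V 0) P i j)))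
    {W : ℕ → Ω → Fin q → ℝ}
    (hW : ∀ n ω i, W n ω i = √n * ((∑ k ∈ Finset.range n, V k ω i) / n - ∫ ω, V 0 ω i ∂P))
    (c : ℝ) :
    chiSquare q (Set.Iio c) ≤ liminf (fun n => P {ω | (Matrix.of (C n ω)).det ≠ 0 ∧
      W n ω ⬝ᵥ (Matrix.of (C n ω))⁻¹ *ᵥ W n ω < c}) atTop := by
  set S := covMat (V 0) P with hS_def
  have hS : S.PosSemidef := posSemidef_covMat hV
  have hclt := tendstoInDistribution_inv_sqrt_smul_sum_sub hV hindep hident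
  have hC_prob : TendstoInMeasure P C atTop fun _ => (fun i j => S i j) := by
    refine tendstoInMeasure_of_tendsto_ae (fun n => (hC_meas n).aestronglyMeasurable) ?_
    filter_upwards [hC] with ω hω
    exact tendsto_pi_nhds.2 fun i => tendsto_pi_nhds.2 fun j => hω i j
  have hpair := hclt.prodMk_of_tendstoInMeasure_const _ C _ hC_prob
    fun n => (hC_meas n).aemeasurable
  have hopen := isOpen_setOf_det_ne_zero_and_quadForm_lt q c
  have hlim := ProbabilityMeasure.le_liminf_measure_open_of_tendsto hpair.tendsto hopen
  simp only [ProbabilityMeasure.coe_mk] at hlim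
  convert! hlim using 1
  · rw [Measure.map_apply (by fun_prop) hopen.measurableSet,
      ← map_dotProduct_inv_mulVec_multivariateGaussian hS hdet,
      Measure.map_apply (by fun_prop) measurableSet_Iio]
    congr 1
    ext x
    simp only [Set.mem_preimage, Set.mem_Iio, Set.mem_ofPred_eq, id]
    exact (and_iff_right hdet).symm
  · congr 1
    ext n
    rw [Measure.map_apply_of_aemeasurable (hpair.forall_aemeasurable n) hopen.measurableSet]
    congr 1
    ext ω
    have hWn : W n ω = ((√(n : ℝ))⁻¹ • (∑ k ∈ Finset.range n, V k ω -
        (n : ℝ) • WithLp.toLp 2 fun i => ∫ ω, V 0 ω i ∂P)).ofLp := by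
      ext i
      rw [hW]
      -- for `n = 0` both sides vanish, since `√0 = 0` and `0⁻¹ = 0`
      rcases Nat.eq_zero_or_pos n with rfl | hn
      · simp
      · have hn' : (0 : ℝ) < n := Nat.cast_pos.2 hn
        have hsq : √(n : ℝ) * √n = n := Real.mul_self_sqrt hn'.le
        have hpos := Real.sqrt_pos.2 hn'
        simp only [PiLp.smul_apply, PiLp.sub_apply, WithLp.ofLp_sum, Finset.sum_apply,
          smul_eq_mul]
        field_simp
        rw [sq, hsq]
    simp only [Set.mem_preimage, Set.mem_ofPred_eq, hWn]

end Wald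

/-! ### Consistency of the sample covariance -/

section SampleCovariance

theorem sum_sub_mean_mul_sub_mean_div (a b : ℕ → ℝ) {n : ℕ} (hn : n ≠ 0) :
    (∑ i ∈ Finset.range n, (a i - (∑ k ∈ Finset.range n, a k) / n) *
      (b i - (∑ k ∈ Finset.range n, b k) / n)) / n =
    (∑ i ∈ Finset.range n, a i * b i) / n -
      (∑ i ∈ Finset.range n, a i) / n * ((∑ i ∈ Finset.range n, b i) / n) := by
  have hn' : (n : ℝ) ≠ 0 := Nat.cast_ne_zero.2 hn
  simp only [sub_mul, mul_sub, Finset.sum_sub_distrib, ← Finset.sum_mul, ← Finset.mul_sum,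
    Finset.sum_const, Finset.card_range, nsmul_eq_mul]
  field_simp
  ring

variable {Ω E : Type*} [MeasurableSpace Ω] [MeasurableSpace E] {P : Measure Ω}
  [IsProbabilityMeasure P]

/-- The sample covariance (with normalization `1 / n`) is strongly consistent. -/
theorem tendsto_sampleCov_ae {Z : ℕ → Ω → E} (hindep : iIndepFun Z P)
    (hident : ∀ k, IdentDistrib (Z k) (Z 0) P P) {a b : E → ℝ} (ha : Measurable a)
    (hb : Measurable b) (ha2 : MemLp (fun ω => a (Z 0 ω)) 2 P)
    (hb2 : MemLp (fun ω => b (Z 0 ω)) 2 P) :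
    ∀ᵐ ω ∂P, Tendsto (fun n : ℕ => (∑ i ∈ Finset.range n,
        (a (Z i ω) - (∑ k ∈ Finset.range n, a (Z k ω)) / n) *
          (b (Z i ω) - (∑ k ∈ Finset.range n, b (Z k ω)) / n)) / n)
      atTop (nhds cov[fun ω => a (Z 0 ω), fun ω => b (Z 0 ω); P]) := by
  have slln {f : E → ℝ} (hf : Measurable f) (hfi : Integrable (fun ω => f (Z 0 ω)) P) :
      ∀ᵐ ω ∂P, Tendsto (fun n : ℕ => (∑ i ∈ Finset.range n, f (Z i ω)) / n) atTop
        (nhds (∫ ω, f (Z 0 ω) ∂P)) :=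
    strong_law_ae_real (fun i ω => f (Z i ω)) hfi
      (fun i j hij => (hindep.indepFun hij).comp hf hf) fun i => (hident i).comp hf
  filter_upwards [slln ha (ha2.integrable one_le_two), slln hb (hb2.integrable one_le_two),
    slln (ha.mul hb) (ha2.integrable_mul hb2)] with ω h1 h2 h3
  rw [covariance_eq_sub ha2 hb2]
  refine (h3.sub (h1.mul h2)).congr' ?_
  filter_upwards [eventually_ne_atTop 0] with n hn
  rw [sum_sub_mean_mul_sub_mean_div _ _ hn]
  rfl

end SampleCovariance

/-! ### Moments under the joint law -/

section Model

theorem sum_pmf_toReal {β : Type*} [Fintype β] (p : PMF β) : ∑ y, (p y).toReal = 1 := by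
  rw [← ENNReal.toReal_sum fun y _ => p.apply_ne_top y, ← tsum_fintype (L := .unconditional _),
    p.tsum_coe, ENNReal.toReal_one]

variable {𝒳 𝒴 𝒮 τ : Type*} {q : ℕ}

/-- The joint law `g` of `(X, θ)` as a real-valued probability vector. -/
noncomputable def trueWeights (g : PMF (𝒳 × 𝒮)) : 𝒳 × 𝒮 → ℝ := fun v => (g v).toReal

/-- The vector of indicators of the events `𝒯(X, Y) = t j`, the last `j` left out. -/
noncomputable def indVec (obs : 𝒳 × 𝒴 → τ) (t : Fin (q + 1) → τ) (z : 𝒳 × 𝒴 × 𝒮) :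
    EuclideanSpace ℝ (Fin q) :=
  WithLp.toLp 2 fun j => ind (t j.castSucc) (obs (z.1, z.2.1))

theorem trueWeights_mem_stdSimplex [Fintype 𝒳] [Fintype 𝒮] (g : PMF (𝒳 × 𝒮)) :
    trueWeights g ∈ stdSimplex ℝ (𝒳 × 𝒮) :=
  ⟨fun _ => ENNReal.toReal_nonneg, sum_pmf_toReal g⟩

theorem jointLaw_apply (g : PMF (𝒳 × 𝒮)) (κ : 𝒳 × 𝒮 → PMF 𝒴) (z : 𝒳 × 𝒴 × 𝒮) :
    jointLaw g κ z = g (z.1, z.2.2) * κ (z.1, z.2.2) z.2.1 := by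
  obtain ⟨x, y, s⟩ := z
  classical
  rw [jointLaw, PMF.bind_apply, tsum_eq_single (x, s)]
  · rw [PMF.map_apply, tsum_eq_single y]
    · simp
    · intro y' hy'
      simp [Ne.symm hy']
  · rintro ⟨x', s'⟩ hv
    rw [PMF.map_apply]
    convert! mul_zero _
    refine ENNReal.tsum_eq_zero.2 fun y' => if_neg ?_
    rintro h
    simp only [Prod.mk.injEq] at h
    exact hv (by rw [h.1, h.2.2])

variable [Fintype 𝒳] [Fintype 𝒴] [Fintype 𝒮]
  [MeasurableSpace 𝒳] [MeasurableSpace 𝒴] [MeasurableSpace 𝒮]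
  [MeasurableSingletonClass 𝒳] [MeasurableSingletonClass 𝒴] [MeasurableSingletonClass 𝒮]

theorem integral_jointLaw (g : PMF (𝒳 × 𝒮)) (κ : 𝒳 × 𝒮 → PMF 𝒴) (f : 𝒳 × 𝒴 × 𝒮 → ℝ) :
    ∫ z, f z ∂(jointLaw g κ).toMeasure =
      ∑ v, trueWeights g v * ∑ y, (κ v y).toReal * f (v.1, y, v.2) := by
  rw [PMF.integral_eq_sum]
  simp only [Fintype.sum_prod_type, jointLaw_apply, trueWeights, Finset.mul_sum,
    ENNReal.toReal_mul, smul_eq_mul, mul_assoc]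
  exact Finset.sum_congr rfl fun x _ => Finset.sum_comm

theorem target_eq_sum (g : PMF (𝒳 × 𝒮)) (κ : 𝒳 × 𝒮 → PMF 𝒴) (h : 𝒳 × 𝒮 → ℝ) :
    target g κ h = ∑ v, h v * trueWeights g v := by
  rw [target, integral_jointLaw g κ (fun z => h (z.1, z.2.2))]
  refine Finset.sum_congr rfl fun v _ => ?_
  dsimp only
  rw [← Finset.sum_mul, sum_pmf_toReal, one_mul, mul_comm]

/-- The vector of indicators has mean `P* g`. -/
theorem integral_indVec_jointLaw (g : PMF (𝒳 × 𝒮)) (κ : 𝒳 × 𝒮 → PMF 𝒴) (obs : 𝒳 × 𝒴 → τ)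
    (t : Fin (q + 1) → τ) (j : Fin q) :
    ∫ z, indVec obs t z j ∂(jointLaw g κ).toMeasure =
      (mixMatrixStar κ obs t *ᵥ trueWeights g) j := by
  classical
  rw [integral_jointLaw]
  simp only [mulVec, dotProduct, mixMatrixStar, mixMatrix, submatrix_apply, of_apply, id]
  refine Finset.sum_congr rfl fun v _ => ?_
  rw [mul_comm, PMF.map_apply, tsum_fintype, ENNReal.toReal_sum fun y _ => ?_]
  · congr 1
    refine Finset.sum_congr rfl fun y _ => ?_
    by_cases hy : t j.castSucc = obs (v.1, y)
    · simp [indVec, ind, hy]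
    · simp [indVec, ind, hy, Ne.symm hy]
  · split_ifs
    · exact (κ v).apply_ne_top y
    · exact ENNReal.zero_ne_top

end Model

/-! ### Perturbing feasible weights -/

section Feasible

variable {𝒳 𝒴 𝒮 τ : Type*} {q : ℕ} [Fintype 𝒳] [Fintype 𝒮]
  {κ : 𝒳 × 𝒮 → PMF 𝒴} {obs : 𝒳 × 𝒴 → τ} {t : Fin (q + 1) → τ} {α : ℝ} {z : ℕ → τ} {n : ℕ}

theorem continuous_quadStat : Continuous (quadStat κ obs t z n) := by
  unfold quadStat
  have h : Continuous fun γ : 𝒳 × 𝒮 → ℝ => empFreqStar t z n - mixMatrixStar κ obs t *ᵥ γ :=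
    continuous_const.sub (continuous_const.matrix_mulVec continuous_id)
  exact continuous_const.mul (h.dotProduct (continuous_const.matrix_mulVec h))

/-- A feasible `γ` can be moved a little towards the vertex `w` of the simplex and stay feasible:
the constraint is a strict inequality, and the statistic is continuous in `γ`. -/
theorem exists_feasible_eq_convexCombo {γ : 𝒳 × 𝒮 → ℝ} (hγ : γ ∈ feasible κ obs t α z n)
    (h : 𝒳 × 𝒮 → ℝ) (w : 𝒳 × 𝒮) :
    ∃ ε : ℝ, 0 < ε ∧ ∃ γ' ∈ feasible κ obs t α z n,
      ∑ v, h v * γ' v = ∑ v, h v * γ v + ε * (h w - ∑ v, h v * γ v) := by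
  classical
  let δ : 𝒳 × 𝒮 → ℝ := Pi.single w 1
  have hcont : Continuous fun ε : ℝ => quadStat κ obs t z n ((1 - ε) • γ + ε • δ) :=
    continuous_quadStat.comp (by fun_prop)
  have hev : ∀ᶠ ε in nhds (0 : ℝ),
      quadStat κ obs t z n ((1 - ε) • γ + ε • δ) < chiSquareCrit q α := by
    refine hcont.continuousAt.eventually_lt continuousAt_const ?_
    simpa using hγ.2
  obtain ⟨ε, ⟨hε_lt, hε_one⟩, hε_pos⟩ := ((hev.and (eventually_le_nhds (zero_lt_one))).filter_mono
    nhdsWithin_le_nhds |>.and (self_mem_nhdsWithin (s := Set.Ioi (0 : ℝ)))).exists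
  refine ⟨ε, hε_pos, (1 - ε) • γ + ε • δ, ⟨?_, hε_lt⟩, ?_⟩
  · exact convex_stdSimplex ℝ _ hγ.1 (single_mem_stdSimplex ℝ w) (sub_nonneg.2 hε_one)
      (le_of_lt hε_pos) (by ring)
  · have hδ : ∑ v, h v * δ v = h w := by simp [δ, Pi.single_apply]
    have hlin : ∑ v, h v * ((1 - ε) • γ + ε • δ) v =
        (1 - ε) * ∑ v, h v * γ v + ε * ∑ v, h v * δ v := by
      simp only [Pi.add_apply, Pi.smul_apply, smul_eq_mul, Finset.mul_sum,
        ← Finset.sum_add_distrib]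
      exact Finset.sum_congr rfl fun v _ => by ring
    rw [hlin, hδ]
    ring

theorem lt_upperEnd {γ : 𝒳 × 𝒮 → ℝ} (hγ : γ ∈ feasible κ obs t α z n) {h : 𝒳 × 𝒮 → ℝ}
    {w : 𝒳 × 𝒮} (hw : ∑ v, h v * γ v < h w) :
    ((∑ v, h v * γ v : ℝ) : EReal) < upperEnd κ obs t h α z n := by
  obtain ⟨ε, hε, γ', hγ', heq⟩ := exists_feasible_eq_convexCombo hγ h w
  have hlt : ∑ v, h v * γ v < ∑ v, h v * γ' v := by
    rw [heq]
    have := mul_pos hε (sub_pos.2 hw)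
    linarith
  exact (EReal.coe_lt_coe_iff.2 hlt).trans_le
    (le_iSup₂ (f := fun γ (_ : γ ∈ feasible κ obs t α z n) => ((∑ v, h v * γ v : ℝ) : EReal)) γ' hγ')

theorem lowerEnd_lt {γ : 𝒳 × 𝒮 → ℝ} (hγ : γ ∈ feasible κ obs t α z n) {h : 𝒳 × 𝒮 → ℝ}
    {w : 𝒳 × 𝒮} (hw : h w < ∑ v, h v * γ v) :
    lowerEnd κ obs t h α z n < ((∑ v, h v * γ v : ℝ) : EReal) := by
  obtain ⟨ε, hε, γ', hγ', heq⟩ := exists_feasible_eq_convexCombo hγ h w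
  have hlt : ∑ v, h v * γ' v < ∑ v, h v * γ v := by
    rw [heq]
    have := mul_neg_of_pos_of_neg hε (sub_neg.2 hw)
    linarith
  exact (iInf₂_le (f := fun γ (_ : γ ∈ feasible κ obs t α z n) =>
    ((∑ v, h v * γ v : ℝ) : EReal)) γ' hγ').trans_lt (EReal.coe_lt_coe_iff.2 hlt)

end Feasible

/-! ### The chi-square test accepts the true weights -/

section Coverage

variable {𝒳 𝒴 𝒮 τ Ω : Type*} [Fintype 𝒳] [Fintype 𝒴] [Fintype 𝒮]
  [MeasurableSpace 𝒳] [MeasurableSpace 𝒴] [MeasurableSpace 𝒮]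
  [MeasurableSingletonClass 𝒳] [MeasurableSingletonClass 𝒴] [MeasurableSingletonClass 𝒮]
  [MeasurableSpace Ω] {μ : Measure Ω} [IsProbabilityMeasure μ]

/-- The asymptotic acceptance probability of the chi-square test at the true weights is at least
`1 - α`; acceptance includes non-singularity of the empirical covariance matrix. -/
theorem le_liminf_measure_quadStat_lt {g : PMF (𝒳 × 𝒮)} {κ : 𝒳 × 𝒮 → PMF 𝒴} {obs : 𝒳 × 𝒴 → τ}
    {q : ℕ} (hq : 1 ≤ q) {t : Fin (q + 1) → τ} {Z : ℕ → Ω → 𝒳 × 𝒴 × 𝒮}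
    (h_meas : ∀ i, Measurable (Z i)) (h_indep : iIndepFun Z μ)
    (h_law : ∀ i, μ.map (Z i) = (jointLaw g κ).toMeasure) {α : ℝ} (hα_pos : 0 < α)
    (h_nonsing : (covStar g κ obs t).det ≠ 0) :
    ENNReal.ofReal (1 - α) ≤ liminf (fun n : ℕ => μ {ω |
      (empCovStar t (fun i => obs ((Z i ω).1, (Z i ω).2.1)) n).det ≠ 0 ∧
      quadStat κ obs t (fun i => obs ((Z i ω).1, (Z i ω).2.1)) n (trueWeights g)
        < chiSquareCrit q α}) atTop := by
  have hmeas_all {F : Type _} [MeasurableSpace F] (f : 𝒳 × 𝒴 × 𝒮 → F) : Measurable f :=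
    measurable_of_finite f
  have hident (k : ℕ) : IdentDistrib (Z k) (Z 0) μ μ :=
    ⟨(h_meas k).aemeasurable, (h_meas 0).aemeasurable, by rw [h_law, h_law]⟩
  set V : ℕ → Ω → EuclideanSpace ℝ (Fin q) := fun k ω => indVec obs t (Z k ω) with hV_def
  have hV_meas (k : ℕ) : Measurable (V k) := (hmeas_all (indVec obs t)).comp (h_meas k)
  have hV (i : Fin q) : MemLp (fun ω => V 0 ω i) 2 μ := by
    -- the indicators are bounded by `1`
    refine MemLp.of_bound (by have := hV_meas 0; fun_prop) 1 (ae_of_all _ fun ω => ?_)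
    simp only [hV_def, indVec, ind]
    exact (norm_indicator_le_norm_self _ _).trans norm_one.le
  have hmean (i : Fin q) : ∫ ω, V 0 ω i ∂μ = (mixMatrixStar κ obs t *ᵥ trueWeights g) i := by
    rw [← integral_indVec_jointLaw, ← h_law 0,
      integral_map (h_meas 0).aemeasurable (hmeas_all _).aestronglyMeasurable]
  have hcov : covMat (V 0) μ = covStar g κ obs t := by
    ext i j
    simp only [covMat, covStar, of_apply]
    rw [← h_law 0, covariance_map_fun (hmeas_all _).aestronglyMeasurable
      (hmeas_all _).aestronglyMeasurable (h_meas 0).aemeasurable]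
    rfl
  have hfreq (n : ℕ) (ω : Ω) (i : Fin q) :
      empFreqStar t (fun i => obs ((Z i ω).1, (Z i ω).2.1)) n i =
        (∑ k ∈ Finset.range n, V k ω i) / n := rfl
  refine (le_chiSquare_Iio_chiSquareCrit q hq hα_pos).trans ?_
  convert! le_liminf_measure_quadForm_lt hV
    (h_indep.comp (fun _ => indVec obs t) fun _ => hmeas_all _)
    (fun k => (hident k).comp (hmeas_all (indVec obs t))) (by rwa [hcov])
    (C := fun n ω => empCovStar t (fun i => obs ((Z i ω).1, (Z i ω).2.1)) n) ?_ ?_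
    (W := fun n ω i => √n * ((∑ k ∈ Finset.range n, V k ω i) / n - ∫ ω, V 0 ω i ∂μ))
    (fun _ _ _ => rfl) (chiSquareCrit q α) using 8 with n ω
  · unfold quadStat
    have hd : (fun i => √(n : ℝ) * ((∑ k ∈ Finset.range n, V k ω i) / n - ∫ ω, V 0 ω i ∂μ)) =
        √(n : ℝ) • (empFreqStar t (fun i => obs ((Z i ω).1, (Z i ω).2.1)) n -
          mixMatrixStar κ obs t *ᵥ trueWeights g) := by
      ext i
      simp [hfreq, hmean]
    rw [hd, mulVec_smul, dotProduct_smul, smul_dotProduct, smul_smul,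
      Real.mul_self_sqrt n.cast_nonneg, smul_eq_mul]
    rfl
  · intro n
    refine measurable_pi_lambda _ fun i => measurable_pi_lambda _ fun j => ?_
    have hi (i : Fin q) (k : ℕ) : Measurable fun ω =>
        ind (t i.castSucc) (obs ((Z k ω).1, (Z k ω).2.1)) :=
      (hmeas_all fun z : 𝒳 × 𝒴 × 𝒮 => ind (t i.castSucc) (obs (z.1, z.2.1))).comp (h_meas k)
    simp only [empCovStar, empFreqStar, empFreq, of_apply]
    fun_prop
  · refine ae_all_iff.2 fun i => ae_all_iff.2 fun j => ?_
    filter_upwards [tendsto_sampleCov_ae h_indep hident (hmeas_all fun z => indVec obs t z i)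
      (hmeas_all fun z => indVec obs t z j) (hV i) (hV j)] with ω hω
    simp only [empCovStar, empFreqStar, empFreq, of_apply, covMat]
    exact hω

end Coverage

end DeconvCI

theorem theorem1
    {𝒳 𝒴 𝒮 τ Ω : Type*}
    [Fintype 𝒳] [Fintype 𝒴] [Fintype 𝒮]
    [MeasurableSpace 𝒳] [MeasurableSpace 𝒴] [MeasurableSpace 𝒮]
    [MeasurableSingletonClass 𝒳] [MeasurableSingletonClass 𝒴] [MeasurableSingletonClass 𝒮]
    [MeasurableSpace Ω] (μ : Measure Ω) [IsProbabilityMeasure μ]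
    -- the law of `(X, θ)`, the conditional law of `Y`, and the map `𝒯`
    (g : PMF (𝒳 × 𝒮)) (κ : 𝒳 × 𝒮 → PMF 𝒴) (obs : 𝒳 × 𝒴 → τ)
    -- the `Q = q + 1 ≥ 2` distinct values of `𝒯`
    (q : ℕ) (hq : 1 ≤ q) (t : Fin (q + 1) → τ)
    (ht_inj : Function.Injective t) (ht_range : Set.range t = Set.range obs)
    -- the i.i.d. sample
    (X : ℕ → Ω → 𝒳) (Y : ℕ → Ω → 𝒴) (θ : ℕ → Ω → 𝒮)
    (h_meas : ∀ i, Measurable fun ω => (X i ω, Y i ω, θ i ω))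
    (h_indep : iIndepFun (fun i ω => (X i ω, Y i ω, θ i ω)) μ)
    (h_law : ∀ i, μ.map (fun ω => (X i ω, Y i ω, θ i ω)) = (DeconvCI.jointLaw g κ).toMeasure)
    (h : 𝒳 × 𝒮 → ℝ) (α : ℝ) (hα_pos : 0 < α) (hα_lt : α < 1)
    (h_nonsing : (DeconvCI.covStar g κ obs t).det ≠ 0) :
    -- coverage by the closed interval
    ENNReal.ofReal (1 - α) ≤
      liminf (fun n : ℕ => μ {ω |
        (DeconvCI.empCovStar t (fun i => obs (X i ω, Y i ω)) n).det ≠ 0 ∧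
        DeconvCI.lowerEnd κ obs t h α (fun i => obs (X i ω, Y i ω)) n
          ≤ (DeconvCI.target g κ h : EReal) ∧
        (DeconvCI.target g κ h : EReal)
          ≤ DeconvCI.upperEnd κ obs t h α (fun i => obs (X i ω, Y i ω)) n}) atTop ∧
    -- coverage by the open interval, unless `T` is an extreme value of `h`
    ((∃ v w, h v < DeconvCI.target g κ h ∧ DeconvCI.target g κ h < h w) →
      ENNReal.ofReal (1 - α) ≤
        liminf (fun n : ℕ => μ {ω |
          (DeconvCI.empCovStar t (fun i => obs (X i ω, Y i ω)) n).det ≠ 0 ∧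
          DeconvCI.lowerEnd κ obs t h α (fun i => obs (X i ω, Y i ω)) n
            < (DeconvCI.target g κ h : EReal) ∧
          (DeconvCI.target g κ h : EReal)
            < DeconvCI.upperEnd κ obs t h α (fun i => obs (X i ω, Y i ω)) n}) atTop) := by
  have hA := DeconvCI.le_liminf_measure_quadStat_lt (obs := obs) hq h_meas h_indep h_law hα_pos
    h_nonsing
  have hfeas (n : ℕ) (ω : Ω) (hω : DeconvCI.quadStat κ obs t (fun i => obs (X i ω, Y i ω)) n
      (DeconvCI.trueWeights g) < DeconvCI.chiSquareCrit q α) :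
      DeconvCI.trueWeights g ∈ DeconvCI.feasible κ obs t α (fun i => obs (X i ω, Y i ω)) n :=
    ⟨DeconvCI.trueWeights_mem_stdSimplex g, hω⟩
  rw [DeconvCI.target_eq_sum]
  refine ⟨hA.trans (liminf_le_liminf (Eventually.of_forall fun n => measure_mono ?_)), ?_⟩
  · rintro ω ⟨hdet, hω⟩
    exact ⟨hdet, iInf₂_le _ (hfeas n ω hω), le_iSup₂_of_le _ (hfeas n ω hω) le_rfl⟩
  · rintro ⟨v, w, hv, hw⟩
    refine hA.trans (liminf_le_liminf (Eventually.of_forall fun n => measure_mono ?_))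
    rintro ω ⟨hdet, hω⟩
    exact ⟨hdet, DeconvCI.lowerEnd_lt (hfeas n ω hω) hv, DeconvCI.lt_upperEnd (hfeas n ω hω) hw⟩
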